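/- Let $X$ be a topological space (no separation axiom is assumed) in which every singleton $\{x\}$ is a $G_\delta$-set, i.e. an intersection of countably many open sets. An open covering $\mathcal U$ of $X$ is called a $\mathcal K$-covering if for every compact $K\subseteq X$ there is $U\in\mathcal U$ with $K\subseteq U$; let $\mathcal K$ be the collection of all $\mathcal K$-coverings of $X$ and $\mathcal O$ the collection of all open coverings of $X$. In the game $G_1^{\omega_1}(\mathcal K,\mathcal O)$, at each inning $\xi<\omega_1$ player I chooses $\mathcal U_\xi\in\mathcal K$ and then player II chooses $U_\xi\in\mathcal U_\xi$; player II wins if $\{U_\xi:\xi<\omega_1\}\in\mathcal O$, that is, if the chosen sets cover $X$. A strategy for player II is a function $F$ that assigns to each sequence $(\mathcal U_\eta)_{\eta\le\xi}$ of $\mathcal K$-coverings with $\xi<\omega_1$ a member $F((\mathcal U_\eta)_{\eta\le\xi})$ of $\mathcal U_\xi$; it is winning if $\{F((\mathcal U_\eta)_{\eta\le\xi}):\xi<\omega_1\}$ covers $X$ for every sequence $(\mathcal U_\xi)_{\xi<\omega_1}$ of $\mathcal K$-coverings. If player II has a winning strategy in $G_1^{\omega_1}(\mathcal K,\mathcal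 O)$, then $|X|\le 2^{\aleph_0}$. -/

import Mathlib

universe u

/-- The family `𝒪` of all open coverings of `X`. -/
def openCovers (X : Type u) [TopologicalSpace X] : Set (Set (Set X)) :=
  {𝒰 | (∀ U ∈ 𝒰, IsOpen U) ∧ ⋃₀ 𝒰 = Set.univ}

/-- The family `𝒦` of all `𝒦`-coverings of `X`: the open coverings such that every compact
subset of `X` is contained in a single member. -/
def compactCovers (X : Type u) [TopologicalSpace X] : Set (Set (Set X)) :=
  {𝒰 | 𝒰 ∈ openCovers X ∧ ∀ K : Set X, IsCompact K → ∃ U ∈ 𝒰, K ⊆ U}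

/-- A strategy for player II in the game `G₁^κ(𝒜, ℬ)`, in which at each inning `ξ < κ` player I
chooses `A ξ ∈ 𝒜` and then player II chooses an element of `A ξ`. The answer at inning `ξ` depends
on the moves of player I at the innings `η ≤ ξ`. -/
structure StrategyII {α : Type u} (κ : Ordinal.{0}) (𝒜 : Set (Set α)) where
  /-- The element chosen at inning `ξ`. -/
  move : (ξ : Set.Iio κ) → (Set.Iic ξ → 𝒜) → α
  /-- The chosen element belongs to the last move of player I. -/
  move_mem : ∀ (ξ : Set.Iio κ) (φ : Set.Iic ξ → 𝒜), move ξ φ ∈ (φ ⟨ξ, Set.mem_Iic.2 le_rfl⟩ : Set α)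

/-- The strategy is winning in `G₁^κ(𝒜, ℬ)`: whatever player I plays, the set of the elements
chosen by player II is a member of `ℬ`. -/
def StrategyII.IsWinning {α : Type u} {κ : Ordinal.{0}} {𝒜 : Set (Set α)}
    (F : StrategyII κ 𝒜) (ℬ : Set (Set α)) : Prop :=
  ∀ A : Set.Iio κ → 𝒜, Set.range (fun ξ : Set.Iio κ => F.move ξ (fun η => A η)) ∈ ℬ

/-- Player II has a winning strategy in the game `G₁^κ(𝒜, ℬ)`. -/
def PlayerIIWins {α : Type u} (κ : Ordinal.{0}) (𝒜 ℬ : Set (Set α)) : Prop :=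
  ∃ F : StrategyII κ 𝒜, F.IsWinning ℬ

open Cardinal Set Filter Topology

section Cardinality

universe v

/-! At each position `p`, a winning strategy for II determines a compact `K p` such that I can make
II play any prescribed open set containing `K p`: otherwise the open sets never played there would
form a `𝒦`-covering. As points are Gδ, `K p` has at most `𝔠` points and is cut out by at most `𝔠`
open sets. Let I only make moves that force one of these. The resulting tree has `ω₁ ≤ 𝔠` levels of
at most `𝔠 ^ ℵ₀ = 𝔠` positions, so the sets `K p` along it cover at most `𝔠` points. They cover `X`:
against a point outside all of them, I could always force an open set that misses it, and II would
lose. -/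

theorem mk_iUnion_le_continuum {α : Type u} {ι : Type v} (f : ι → Set α) (hι : #ι ≤ 𝔠)
    (hf : ∀ i, #(f i) ≤ 𝔠) : #(⋃ i, f i) ≤ 𝔠 := by
  have h := mk_iUnion_le_lift f
  have h1 : lift.{u} #ι ≤ 𝔠 := lift_le_continuum.2 hι
  have h2 : (⨆ i, lift.{v} #(f i)) ≤ 𝔠 := ciSup_le' fun i => lift_le_continuum.2 (hf i)
  exact lift_le_continuum.1 (h.trans ((mul_le_mul' h1 h2).trans continuum_mul_self.le))

/-- A space with a family of at most continuum many operations of countable arity has a nonempty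
subset of cardinality at most the continuum that is closed under these operations. -/
theorem exists_closed_mk_le_continuum {α : Type u} {ι : Type} (hι : #ι ≤ 𝔠)
    (op : ι → (ℕ → α) → α) (a : α) :
    ∃ H : Set α, a ∈ H ∧ #H ≤ 𝔠 ∧ ∀ i s, (∀ n, s n ∈ H) → op i s ∈ H := by
  let β : Option ι → Type := fun o => o.elim Empty fun _ => ℕ
  -- The closure of `a` is the set of values of well-founded terms with countable branching; there
  -- are at most `𝔠` of these.
  let ev : WType β → α := WType.elim α fun x =>
    match x with
    | ⟨none, _⟩ => a
    | ⟨some i, s⟩ => op i s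
  have hW : #(WType β) ≤ 𝔠 := by
    apply WType.cardinalMk_le_of_le'
    have hb : ∀ o : Option ι, (𝔠 : Cardinal.{0}) ^ lift.{0} #(β o) ≤ 𝔠 := by
      rintro (_ | i)
      · simpa [β] using one_le_aleph0.trans aleph0_le_continuum
      · simp [β]
    refine (sum_le_sum _ _ hb).trans ?_
    rw [sum_const', mk_option]
    exact (mul_le_mul' (add_le_of_le aleph0_le_continuum hι
      (one_le_aleph0.trans aleph0_le_continuum)) le_rfl).trans continuum_mul_self.le
  refine ⟨range ev, ⟨WType.mk none Empty.elim, rfl⟩, ?_, ?_⟩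
  · exact lift_le_continuum.1 (mk_range_le_lift.trans (lift_le_continuum.2 hW))
  · intro i s hs
    choose w hw using hs
    refine ⟨WType.mk (some i) w, ?_⟩
    change op i (fun n => ev (w n)) = op i s
    congr 1
    exact funext hw

end Cardinality

section CompactSpaces

variable {X : Type u} [TopologicalSpace X]

/-- If all points are `Gδ`, a countably compact subset of a compact space is compact. -/
theorem isCompact_of_seq_clusterPt [CompactSpace X] (hG : ∀ x : X, IsGδ ({x} : Set X))
    {H : Set X} (hH : ∀ s : ℕ → X, (∀ n, s n ∈ H) → ∃ z ∈ H, MapClusterPt z atTop s) :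
    IsCompact H := by
  classical
  refine isCompact_of_finite_subcover fun {ι} W hWo hW => ?_
  by_contra! hno
  -- Without separation `H` need not be closed, so a maximal open family having no finite subcover
  -- of `H` is used instead.
  let S : Set (Set (Set X)) :=
    {𝒱 | (∀ V ∈ 𝒱, IsOpen V) ∧ ∀ t : Finset (Set X), ↑t ⊆ 𝒱 → ¬ H ⊆ ⋃₀ (t : Set (Set X))}
  have hbase : range W ∈ S := by
    refine ⟨by rintro _ ⟨i, rfl⟩; exact hWo i, fun t ht hc => ?_⟩
    choose i hi using fun V : t => ht V.2
    refine hno (Finset.univ.image i) (hc.trans ?_)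
    rintro x ⟨V, hV, hx⟩
    exact mem_iUnion₂.2 ⟨i ⟨V, hV⟩, Finset.mem_image_of_mem i (Finset.mem_univ _), by rwa [hi]⟩
  obtain ⟨𝒱, hle, hmax⟩ := zorn_subset_nonempty S (fun c hc hchain hne => by
    refine ⟨⋃₀ c, ⟨?_, fun t ht => ?_⟩, fun s hs => subset_sUnion_of_mem hs⟩
    · rintro V ⟨d, hd, hV⟩
      exact (hc hd).1 V hV
    · obtain ⟨d, hd, htd⟩ := DirectedOn.exists_mem_subset_of_finset_subset_biUnion
        (f := fun d : Set (Set X) => d) (s := t) (c := c) hne hchain.directedOn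
        (by rwa [← sUnion_eq_biUnion])
      exact (hc hd).2 t htd) _ hbase
  -- By compactness `𝒱` cannot cover `X`. By maximality each `U n` around an uncovered `q` covers
  -- `H` together with finitely many members of `𝒱`.
  obtain ⟨q, hq⟩ : ∃ q, q ∉ ⋃₀ 𝒱 := by
    by_contra! hall
    obtain ⟨t, ht⟩ := isCompact_univ.elim_finite_subcover (fun V : 𝒱 => (V : Set X))
      (fun V => hmax.prop.1 V V.2) fun x _ => by simpa using hall x
    refine hmax.prop.2 (t.image Subtype.val) (by simp) fun x _ => ?_
    obtain ⟨V, hV, hx⟩ := mem_iUnion₂.1 (ht (mem_univ x))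
    exact ⟨V, Finset.mem_coe.2 (Finset.mem_image_of_mem _ hV), hx⟩
  have hqH : q ∉ H := fun h => hq (sUnion_mono hle (by simpa using hW h))
  obtain ⟨U, hUo, hU⟩ := isGδ_iff_eq_iInter_nat.1 (hG q)
  have hqU : ∀ n, q ∈ U n := mem_iInter.1 (hU ▸ mem_singleton q)
  have hfin : ∀ n, ∃ t : Finset (Set X), ↑t ⊆ 𝒱 ∧ H ⊆ U n ∪ ⋃₀ (t : Set (Set X)) := by
    intro n
    have hn : insert (U n) 𝒱 ∉ S := fun h =>
      hq ⟨U n, hmax.le_of_ge h (subset_insert _ _) (mem_insert _ _), hqU n⟩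
    have : ∃ t : Finset (Set X), (t : Set (Set X)) ⊆ insert (U n) 𝒱 ∧
        H ⊆ ⋃₀ (t : Set (Set X)) := by
      by_contra! h
      exact hn ⟨by rintro V (rfl | hV); exacts [hUo n, hmax.prop.1 V hV], h⟩
    obtain ⟨t, ht, hcov⟩ := this
    refine ⟨t.erase (U n), ?_, fun x hx => ?_⟩
    · intro V hV
      have hV' := Finset.mem_erase.1 (Finset.mem_coe.1 hV)
      exact (ht hV'.2).resolve_left hV'.1
    · obtain ⟨V, hV, hxV⟩ := hcov hx
      by_cases h : V = U n
      · exact Or.inl (h ▸ hxV)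
      · exact Or.inr ⟨V, Finset.mem_coe.2 (Finset.mem_erase.2 ⟨h, hV⟩), hxV⟩
  choose t ht hcov using hfin
  -- A cluster point in `H` differs from `q`, so it misses some `U n` and lies in a member of `t n`,
  -- which the sequence avoids from `n` on.
  have hpt : ∀ n, ∃ x ∈ H, x ∉ ⋃₀ (((Finset.range (n + 1)).biUnion t : Finset _) : Set (Set X)) := by
    intro n
    refine not_subset.1 (hmax.prop.2 _ ?_)
    intro V hV
    obtain ⟨i, -, hi⟩ := Finset.mem_biUnion.1 (Finset.mem_coe.1 hV)
    exact ht i hi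
  choose s hsH hs using hpt
  obtain ⟨z, hzH, hz⟩ := hH s hsH
  have hzq : z ∉ ⋂ n, U n := by
    rw [← hU]
    rintro rfl
    exact hqH hzH
  obtain ⟨n, hn⟩ : ∃ n, z ∉ U n := by simpa using hzq
  obtain ⟨V, hV, hzV⟩ := (hcov n hzH).resolve_left hn
  have hfreq := mapClusterPt_iff_frequently.1 hz V
    ((hmax.prop.1 V (ht n hV)).mem_nhds hzV)
  obtain ⟨m, hnm, hm⟩ := (frequently_atTop.1 hfreq) n
  exact hs m ⟨V, Finset.mem_coe.2 (Finset.mem_biUnion.2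
    ⟨n, Finset.mem_range.2 (Nat.lt_succ_of_le hnm), hV⟩), hm⟩

/-- A compact space in which all points are `Gδ` has cardinality at most the continuum. -/
theorem mk_le_continuum_of_compactSpace [CompactSpace X] (hG : ∀ x : X, IsGδ ({x} : Set X)) :
    #X ≤ 𝔠 := by
  classical
  rcases isEmpty_or_nonempty X with _ | ⟨⟨a⟩⟩
  · simp
  choose U hUo hU using fun x => isGδ_iff_eq_iInter_nat.1 (hG x)
  have hlim : ∀ s : ℕ → X, ∃ z, MapClusterPt z atTop s := fun s =>
    exists_clusterPt_of_compactSpace (map s atTop)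
  choose L hL using hlim
  -- Closing under this operation puts into `H` a witness that finitely many basic neighbourhoods of
  -- points of `H` fail to cover `X`. The index encodes which neighbourhoods, and how many.
  let outside : (ℕ → ℕ) × ℕ → (ℕ → X) → X := fun e s =>
    if h : ∃ y, ∀ i < e.2, y ∉ U (s i) (e.1 i) then h.choose else a
  let op : Option ((ℕ → ℕ) × ℕ) → (ℕ → X) → X := fun o => o.elim L outside
  have hι : #(Option ((ℕ → ℕ) × ℕ)) ≤ 𝔠 := by
    simpa using add_le_of_le aleph0_le_continuum le_rfl (one_le_aleph0.trans aleph0_le_continuum)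
  obtain ⟨H, haH, hcard, hop⟩ := exists_closed_mk_le_continuum hι op a
  have hcomp : IsCompact H :=
    isCompact_of_seq_clusterPt hG fun s hs => ⟨L s, hop none s hs, hL s⟩
  suffices H = Set.univ by rwa [this, mk_univ] at hcard
  refine eq_univ_of_forall fun y => by_contra fun hy => ?_
  have hn : ∀ x ∈ H, ∃ n, y ∉ U x n := by
    intro x hx
    have : y ∉ ⋂ n, U x n := by
      rw [← hU]
      rintro rfl
      exact hy hx
    simpa using this
  choose! n hn using hn
  have hmem : ∀ x k, x ∈ U x k := fun x => mem_iInter.1 (hU x ▸ mem_singleton x)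
  obtain ⟨t, ht⟩ := hcomp.elim_finite_subcover (fun x : H => U x (n x)) (fun x => hUo _ _)
    fun x hx => mem_iUnion.2 ⟨⟨x, hx⟩, hmem _ _⟩
  let s : ℕ → X := fun i => (t.toList.getD i ⟨a, haH⟩ : H)
  have hsH : ∀ i, s i ∈ H := fun i => Subtype.coe_prop _
  have hex : ∃ y, ∀ i < t.card, y ∉ U (s i) (n (s i)) := ⟨y, fun i _ => hn _ (hsH i)⟩
  have hout := hop (some (fun i => n (s i), t.card)) s hsH
  have heq : op (some (fun i => n (s i), t.card)) s = hex.choose := dif_pos hex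
  rw [heq] at hout
  obtain ⟨x, hx, hxU⟩ := mem_iUnion₂.1 (ht hout)
  obtain ⟨i, hi, rfl⟩ := List.mem_iff_getElem.1 (Finset.mem_toList.2 hx)
  have hs : s i = (t.toList[i] : H) := by
    simp only [s]
    rw [List.getD_eq_getElem _ _ hi]
  exact hex.choose_spec i (by simpa using hi) (by rw [hs]; exact hxU)

theorem IsCompact.mk_le_continuum (hG : ∀ x : X, IsGδ ({x} : Set X)) {K : Set X}
    (hK : IsCompact K) : #K ≤ 𝔠 := by
  have := isCompact_iff_compactSpace.1 hK
  refine mk_le_continuum_of_compactSpace fun x => ?_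
  have h := (hG x).preimage (continuous_subtype_val (p := (· ∈ K)))
  convert h using 1
  ext z
  simp [Subtype.ext_iff]

/-- If all points are `Gδ`, a compact set is the intersection of at most continuum many open
sets. -/
theorem IsCompact.exists_open_family (hG : ∀ x : X, IsGδ ({x} : Set X)) {K : Set X}
    (hK : IsCompact K) {C : Type u} (hC : #C = 𝔠) :
    ∃ V : C → Set X, (∀ c, IsOpen (V c) ∧ K ⊆ V c) ∧ ∀ y ∉ K, ∃ c, y ∉ V c := by
  classical
  choose U hUo hU using fun x => isGδ_iff_eq_iInter_nat.1 (hG x)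
  -- For `y ∉ K`, each point of `K` has some `U x n` missing `y`; by compactness a finite union of
  -- these separates `K` from `y`.
  let W : Finset (K × ℕ) → Set X := fun t => ⋃ x ∈ t, U x.1 x.2
  have hWo : ∀ t, IsOpen (W t) := fun t => isOpen_biUnion fun _ _ => hUo _ _
  have hcard : #(Finset (K × ℕ)) ≤ #C := by
    rw [hC]
    refine (mk_le_of_surjective List.toFinset_surjective).trans ((mk_list_le_max _).trans ?_)
    refine max_le aleph0_le_continuum ?_
    rw [mk_prod]
    refine (mul_le_mul' (lift_le_continuum.2 (hK.mk_le_continuum hG))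
      (lift_le_continuum.2 (mk_le_aleph0.trans aleph0_le_continuum))).trans continuum_mul_self.le
  obtain ⟨e⟩ := hcard
  have hsurj : Function.Surjective (Function.invFun e) := Function.invFun_surjective e.injective
  let V : C → Set X := fun c => if K ⊆ W (Function.invFun e c) then W (Function.invFun e c) else univ
  refine ⟨V, fun c => ?_, fun y hy => ?_⟩
  · by_cases h : K ⊆ W (Function.invFun e c)
    · simp only [V, if_pos h]
      exact ⟨hWo _, h⟩
    · simp only [V, if_neg h]
      exact ⟨isOpen_univ, subset_univ _⟩
  · have hn : ∀ x : K, ∃ n, y ∉ U x n := by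
      intro x
      have : y ∉ ⋂ n, U x n := by
        rw [← hU]
        rintro rfl
        exact hy x.2
      simpa using this
    choose n hn using hn
    obtain ⟨t, ht⟩ := hK.elim_finite_subcover (fun x : K => U x (n x)) (fun x => hUo _ _)
      fun x hx => mem_iUnion.2 ⟨⟨x, hx⟩, mem_iInter.1 (hU x ▸ mem_singleton x) _⟩
    obtain ⟨c, hc⟩ := hsurj (t.image fun x => (x, n x))
    have hKW : K ⊆ W (Function.invFun e c) := by
      rw [hc]
      intro x hx
      obtain ⟨z, hz, hxz⟩ := mem_iUnion₂.1 (ht hx)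
      exact mem_iUnion₂.2 ⟨(z, n z), Finset.mem_image_of_mem _ hz, hxz⟩
    refine ⟨c, ?_⟩
    simp only [V, if_pos hKW]
    rw [hc]
    simpa [W] using fun x hx _ => hn ⟨x, hx⟩

end CompactSpaces

section Game

variable {X : Type u} [TopologicalSpace X] {κ : Ordinal.{0}}

/-- The moves of player I up to inning `ξ`: the moves `p` at the earlier innings, then `A`. -/
noncomputable def extendMoves {β : Type u} {ξ : Iio κ} (p : Iio ξ → β) (A : β) : Iic ξ → β :=
  open Classical in fun η => if h : (η : Iio κ) < ξ then p ⟨η, h⟩ else A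

theorem extendMoves_restrict {β : Type u} {ξ : Iio κ} (g : Iio κ → β) :
    extendMoves (ξ := ξ) (fun η => g η) (g ξ) = fun η : Iic ξ => g η := by
  funext η
  by_cases h : (η : Iio κ) < ξ
  · simp [extendMoves, h]
  · simp [extendMoves, le_antisymm (mem_Iic.1 η.2) (not_lt.1 h)]

theorem extendMoves_last {β : Type u} {ξ : Iio κ} (p : Iio ξ → β) (A : β) :
    extendMoves p A ⟨ξ, mem_Iic.2 le_rfl⟩ = A := by
  simp [extendMoves]

/-- At each position there is a compact set such that player II, following a given strategy, can be
made to choose any prescribed open set containing it. -/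
theorem StrategyII.exists_isCompact_forall_move_eq (F : StrategyII κ (compactCovers X)) (ξ : Iio κ)
    (p : Iio ξ → compactCovers X) :
    ∃ K : Set X, IsCompact K ∧ ∀ V, IsOpen V → K ⊆ V →
      ∃ 𝒰, F.move ξ (extendMoves p 𝒰) = V := by
  by_contra! hno
  let 𝒱 : Set (Set X) := {V | IsOpen V ∧ ∀ 𝒰, F.move ξ (extendMoves p 𝒰) ≠ V}
  have hK : ∀ K : Set X, IsCompact K → ∃ V ∈ 𝒱, K ⊆ V := fun K hK => by
    obtain ⟨V, hVo, hKV, hV⟩ := hno K hK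
    exact ⟨V, ⟨hVo, hV⟩, hKV⟩
  have h𝒱 : 𝒱 ∈ compactCovers X := by
    refine ⟨⟨fun V hV => hV.1, eq_univ_of_forall fun x => ?_⟩, hK⟩
    obtain ⟨V, hV, hx⟩ := hK {x} isCompact_singleton
    exact ⟨V, hV, hx rfl⟩
  have hmem := F.move_mem ξ (extendMoves p ⟨𝒱, h𝒱⟩)
  rw [extendMoves_last] at hmem
  exact hmem.2 _ rfl

/-- The positions before inning `ξ` in which player I has made each move according to `U`, with a
parameter in `C`. -/
def treePositions {β C : Type u} (U : (ξ : Iio κ) → (Iio ξ → β) → C → β) (ξ : Iio κ) :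
    Set (Iio ξ → β) :=
  {p | ∀ η : Iio ξ, ∃ c, p η = U η (fun ζ => p ⟨ζ, lt_trans (mem_Iio.1 ζ.2) η.2⟩) c}

/-- By recursion along the innings, a position is determined by its countable sequence of
parameters. -/
theorem mk_treePositions_le {β C : Type u} (U : (ξ : Iio κ) → (Iio ξ → β) → C → β) (ξ : Iio κ)
    (hC : #C = 𝔠) [Countable (Iio ξ)] : #(treePositions U ξ) ≤ 𝔠 := by
  choose c hc using fun p : treePositions U ξ => p.2
  have hinj : Function.Injective c := by
    intro p q hpq
    have key : ∀ η : Iio κ, ∀ h : η < ξ, p.1 ⟨η, h⟩ = q.1 ⟨η, h⟩ := by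
      intro η
      induction η using WellFoundedLT.induction with
      | ind η ih =>
        intro h
        rw [hc p ⟨η, h⟩, hc q ⟨η, h⟩, hpq]
        congr 1
        funext ζ
        exact ih ζ ζ.2 _
    exact Subtype.ext (funext fun η => key η η.2)
  refine (mk_le_of_injective hinj).trans ?_
  rw [mk_arrow, hC, lift_continuum]
  refine (power_le_power_left continuum_ne_zero
    (lift_le_aleph0.2 (mk_le_aleph0 (α := Iio ξ)))).trans ?_
  rw [continuum_power_aleph0]

theorem countable_Iio_of_lt_omega_one (ξ : Iio (Ordinal.omega.{0} 1)) : Countable (Iio ξ) := by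
  have h : (ξ : Ordinal.{0}).card ≤ ℵ₀ := by
    have : (ξ : Ordinal.{0}) < _ := ξ.2
    generalize (ξ : Ordinal.{0}) = o at this ⊢
    rw [ ← ord_aleph, lt_ord, ← succ_aleph0] at this
    exact Order.lt_succ_iff.1 this
  have : Countable (Iio (ξ : Ordinal.{0})) := by
    rw [← mk_le_aleph0_iff, mk_Iio_ordinal]
    exact lift_le_aleph0.2 h
  exact Function.Injective.countable (f := fun η : Iio ξ => (⟨η.1, η.2⟩ : Iio (ξ : Ordinal.{0})))
    fun a b hab => Subtype.ext (Subtype.ext (congrArg (fun z : Iio (ξ : Ordinal.{0}) => z.1) hab))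

end Game

theorem theorem2p9 (X : Type u) [TopologicalSpace X] (hG : ∀ x : X, IsGδ ({x} : Set X))
    (hII : PlayerIIWins (Ordinal.omega 1) (compactCovers X) (openCovers X)) :
    Cardinal.mk X ≤ 2 ^ Cardinal.aleph0 := by
  obtain ⟨F, hF⟩ := hII
  rw [two_power_aleph0]
  let C : Type u := (𝔠 : Cardinal.{u}).out
  have hC : #C = 𝔠 := mk_out _
  have : Nonempty C := mk_ne_zero_iff.1 (hC ▸ continuum_ne_zero)
  choose K hK hans using F.exists_isCompact_forall_move_eq
  choose V hV hsep using fun ξ p => (hK ξ p).exists_open_family hG hC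
  choose U hU using fun ξ p c => hans ξ p (V ξ p c) (hV ξ p c).1 (hV ξ p c).2
  have hlevel : ∀ ξ, #(treePositions U ξ) ≤ 𝔠 := fun ξ =>
    have := countable_Iio_of_lt_omega_one ξ
    mk_treePositions_le U ξ hC
  have hinn : #(Iio (Ordinal.omega.{0} 1)) ≤ 𝔠 := by
    rw [mk_Iio_ordinal, Ordinal.card_omega]
    exact lift_le_continuum.2 aleph_one_le_continuum
  have hcard : #(⋃ ξ, ⋃ p : treePositions U ξ, K ξ p) ≤ 𝔠 :=
    mk_iUnion_le_continuum _ hinn fun ξ => mk_iUnion_le_continuum _ (hlevel ξ) fun p =>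
      (hK ξ p).mk_le_continuum hG
  suffices (⋃ ξ, ⋃ p : treePositions U ξ, K ξ p) = Set.univ by rwa [this, mk_univ] at hcard
  refine eq_univ_of_forall fun y => by_contra fun hy => ?_
  simp only [mem_iUnion, not_exists] at hy
  have hsel : ∀ ξ p, ∃ c, y ∉ K ξ p → y ∉ V ξ p c := fun ξ p => by
    by_cases h : y ∈ K ξ p
    · exact ⟨Classical.arbitrary C, fun h' => absurd h h'⟩
    · obtain ⟨c, hc⟩ := hsep ξ p y h
      exact ⟨c, fun _ => hc⟩
  choose c hc using hsel
  -- The play against `y`: I always picks the parameter whose forced open set misses `y`. It stays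
  -- in the tree, so `y ∉ K` at every inning.
  let g : Iio (Ordinal.omega 1) → compactCovers X :=
    IsWellFounded.fix (· < ·) fun ξ p => U ξ (fun η => p η η.2) (c ξ fun η => p η η.2)
  have hg : ∀ ξ, g ξ = U ξ (fun η => g η) (c ξ fun η => g η) := fun ξ =>
    IsWellFounded.fix_eq (· < ·) _ ξ
  have hmiss : ∀ ξ, y ∉ F.move ξ fun η => g η := by
    intro ξ
    have hpos : (fun η : Iio ξ => g η) ∈ treePositions U ξ := fun η => ⟨_, hg η⟩
    have hmove := hU ξ (fun η => g η) (c ξ fun η => g η)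
    rw [← hg ξ, extendMoves_restrict] at hmove
    rw [hmove]
    exact hc ξ _ (hy ξ ⟨_, hpos⟩)
  have hy' : y ∈ ⋃₀ range fun ξ => F.move ξ fun η => g η := (hF g).2 ▸ mem_univ y
  obtain ⟨_, ⟨ξ, rfl⟩, hmem⟩ := hy'
  exact hmiss ξ hmem
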